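/- A skew brace is a set $A$ with two group structures $(A,+)$ and $(A,\circ)$ (neither assumed commutative) such that $a\circ(b+c)=a\circ b-a+a\circ c$ for all $a,b,c\in A$; it is of abelian type if $(A,+)$ is abelian. Put $\lambda_a(x)=-a+a\circ x$; this defines an action of $(A,\circ)$ on $(A,+)$ by automorphisms, and $\theta_{(a,b)}(c)=a+\lambda_b(c)-a$ defines an action of $(A,+)\rtimes_\lambda(A,\circ)$ on $(A,+)$ by automorphisms. For finite $A$, the $\theta$-graph $\Theta(A)$ is the simple graph whose vertices are the $\theta$-orbits with more than one element, two different orbits $L_1,L_2$ being adjacent if $\gcd(|L_1|,|L_2|)\neq 1$. **Theorem.** Let $A$ be a finite skew brace such that $\Theta(A)$ has exactly one vertex. Then $A$ is of abelian type, and $A$ is isomorphic, as a skew brace, to one of the following three skew braces, each with the usual addition of the group on which it is defined: 1. the skew brace on $\mathbb{Z}/4\mathbb{Z}$ with $x\circ y=x+y+2xy$; 2. the skew brace on $\mathbb{Z}/2\mathbb{Z}\times\mathbb{Z}/2\mathbb{Z}$ with $(x_1,y_1)\circ(x_2,y_2)=(x_1+x_2+y_1y_2,\;y_1+y_2)$;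 3. the skew brace on $\mathbb{Z}/2\mathbb{Z}\times\mathbb{Z}/4\mathbb{Z}$ with $$(x_1,y_1)\circ(x_2,y_2)=\Bigl(x_1+x_2+y_2\sum_{i=1}^{y_1-1}i,\;\;y_1+y_2+2y_1y_2\Bigr),$$ where in the sum $y_1$ is represented by an integer in $\{0,1,2,3\}$ (the sum is empty for $y_1\in\{0,1\}$) and the first coordinate is read modulo $2$. -/

import Mathlib

/-- A skew brace `(A, +, ∘)`: the operation `∘` is written `*` and the inverse of `a` for `∘` is
written `a⁻¹`. The additive group need not be commutative. -/
class SkewBrace (A : Type*) extends AddGroup A, Group A where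
  mul_add_skew : ∀ a b c : A, a * (b + c) = a * b - a + a * c

namespace SkewBrace

section CommonDivisorGraph

variable {G H : Type*} [Group G] [Group H]

/-- The orbit of `a` under an action `α` by automorphisms. -/
def orbit (α : G →* MulAut H) (a : H) : Set H := Set.range fun g : G => α g a

/-- The non-trivial orbits (those with more than one element) of an action `α` by automorphisms
of a finite group on a finite group. -/
def NontrivialOrbit (α : G →* MulAut H) : Type _ :=
  {L : Set H // (∃ a : H, L = orbit α a) ∧ 1 < L.ncard}

/-- The common divisor graph of an action `α` by automorphisms: the vertices are the non-trivial
orbits, and two different orbits are adjacent if their sizes are not coprime. -/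
def commonDivisorGraph (α : G →* MulAut H) : SimpleGraph (NontrivialOrbit α) where
  Adj L₁ L₂ := L₁ ≠ L₂ ∧ Nat.gcd L₁.1.ncard L₂.1.ncard ≠ 1
  symm := ⟨fun _ _ h => ⟨h.1.symm, by rw [Nat.gcd_comm]; exact h.2⟩⟩
  loopless := ⟨fun _ h => h.1 rfl⟩

end CommonDivisorGraph

section Actions

variable {A : Type*} [SkewBrace A]

theorem mul_zero_skew (a : A) : a * (0 : A) = a := by
  have h := mul_add_skew a 0 0
  rw [add_zero] at h
  have h2 : a * (0 : A) + 0 = a * 0 + (-a + a * 0) := by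
    rw [add_zero, ← add_assoc, ← sub_eq_add_neg]; exact h
  have h3 := add_left_cancel h2
  have h4 : a + 0 = a + (-a + a * 0) := by rw [← h3]
  rw [add_zero, add_neg_cancel_left] at h4
  exact h4.symm

theorem zero_eq_one_skew : (0 : A) = 1 := by
  have h := mul_zero_skew (1 : A)
  rwa [one_mul] at h

theorem lambda_add (a x y : A) : -a + a * (x + y) = (-a + a * x) + (-a + a * y) := by
  rw [mul_add_skew, sub_eq_add_neg]; simp only [add_assoc]

theorem lambda_mul (a b x : A) : -(a * b) + a * b * x = -a + a * (-b + b * x) := by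
  have h := mul_add_skew a b (-b + b * x)
  rw [add_neg_cancel_left, ← mul_assoc] at h
  rw [h, sub_eq_add_neg]
  simp only [add_assoc, neg_add_cancel_left]

theorem lambda_one (x : A) : -(1 : A) + 1 * x = x := by
  rw [← zero_eq_one_skew (A := A), neg_zero, zero_add, zero_eq_one_skew, one_mul]

/-- The automorphism `λ_a : x ↦ -a + a ∘ x` of `(A, +)`. -/
def lambdaEquiv (a : A) : A ≃+ A where
  toFun x := -a + a * x
  invFun x := -a⁻¹ + a⁻¹ * x
  left_inv x := by
    change -a⁻¹ + a⁻¹ * (-a + a * x) = x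
    rw [← lambda_mul, inv_mul_cancel, lambda_one]
  right_inv x := by
    change -a + a * (-a⁻¹ + a⁻¹ * x) = x
    rw [← lambda_mul, mul_inv_cancel, lambda_one]
  map_add' := lambda_add a

variable (A)

/-- The action `λ` of `(A, ∘)` on `(A, +)` by automorphisms. -/
def lambda : A →* MulAut (Multiplicative A) where
  toFun a := AddEquiv.toMultiplicative (lambdaEquiv a)
  map_one' := MulEquiv.ext fun x => congrArg Multiplicative.ofAdd (lambda_one x.toAdd)
  map_mul' a b := MulEquiv.ext fun x => congrArg Multiplicative.ofAdd (lambda_mul a b x.toAdd)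

/-- The action `θ` of `(A, +) ⋊_λ (A, ∘)` on `(A, +)` by automorphisms,
`θ_{(a,b)}(c) = a + λ_b(c) - a` (see `theta_apply`). -/
def theta : (Multiplicative A ⋊[lambda A] A) →* MulAut (Multiplicative A) :=
  SemidirectProduct.lift MulAut.conj (lambda A) fun g => by
    ext n x
    simp [MulAut.conj_apply, MulAut.mul_apply]

variable {A}

theorem lambda_apply (a x : A) :
    (lambda A a (Multiplicative.ofAdd x)).toAdd = -a + a * x := rfl

theorem theta_apply (a b c : A) :
    (theta A ⟨Multiplicative.ofAdd a, b⟩ (Multiplicative.ofAdd c)).toAdd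
      = a + (-b + b * c) - a := by
  rw [sub_eq_add_neg]; rfl

end Actions

/-- The `θ`-graph of a skew brace. -/
def thetaGraph (A : Type*) [SkewBrace A] : SimpleGraph (NontrivialOrbit (theta A)) :=
  commonDivisorGraph (theta A)

/-- The graph `Γ` on the vertex set `V` has exactly one vertex. -/
def HasExactlyOneVertex {V : Type*} (_Γ : SimpleGraph V) : Prop := Nat.card V = 1

/-- A skew brace is of abelian type if its additive group is abelian. -/
def IsOfAbelianType (A : Type*) [SkewBrace A] : Prop := ∀ a b : A, a + b = b + a

/-- The carrier `ℤ/4` of the first skew brace. -/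
def BraceZ4 : Type := ZMod 4

/-- The usual addition of `ℤ/4`, with `x ∘ y = x + y + 2xy`. -/
instance : SkewBrace BraceZ4 :=
  { (inferInstanceAs (AddGroup (ZMod 4)) : AddGroup BraceZ4) with
    mul := fun x y : ZMod 4 => (x + y + 2 * x * y : ZMod 4)
    one := (0 : ZMod 4)
    inv := fun x : ZMod 4 => (-x - 2 * x * x : ZMod 4)
    mul_assoc := (by decide : ∀ x y z : ZMod 4,
      (x + y + 2 * x * y) + z + 2 * (x + y + 2 * x * y) * z
        = x + (y + z + 2 * y * z) + 2 * x * (y + z + 2 * y * z))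
    one_mul := (by decide : ∀ x : ZMod 4, 0 + x + 2 * 0 * x = x)
    mul_one := (by decide : ∀ x : ZMod 4, x + 0 + 2 * x * 0 = x)
    inv_mul_cancel := (by decide : ∀ x : ZMod 4,
      (-x - 2 * x * x) + x + 2 * (-x - 2 * x * x) * x = 0)
    mul_add_skew := (by decide : ∀ x y z : ZMod 4,
      x + (y + z) + 2 * x * (y + z) = (x + y + 2 * x * y) - x + (x + z + 2 * x * z)) }

/-- The carrier `ℤ/2 × ℤ/2` of the second skew brace. -/
def BraceZ2Z2 : Type := ZMod 2 × ZMod 2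

/-- The operation `(x₁, y₁) ∘ (x₂, y₂) = (x₁ + x₂ + y₁y₂, y₁ + y₂)` on `ℤ/2 × ℤ/2`. -/
def circZ2Z2 (a b : ZMod 2 × ZMod 2) : ZMod 2 × ZMod 2 :=
  (a.1 + b.1 + a.2 * b.2, a.2 + b.2)

/-- The usual addition of `ℤ/2 × ℤ/2`, with the operation `circZ2Z2`. -/
instance : SkewBrace BraceZ2Z2 :=
  { (inferInstanceAs (AddGroup (ZMod 2 × ZMod 2)) : AddGroup BraceZ2Z2) with
    mul := circZ2Z2
    one := ((0, 0) : ZMod 2 × ZMod 2)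
    inv := fun a : ZMod 2 × ZMod 2 => ((-a.1 - a.2 * a.2, -a.2) : ZMod 2 × ZMod 2)
    mul_assoc := (by decide : ∀ a b c : ZMod 2 × ZMod 2,
      circZ2Z2 (circZ2Z2 a b) c = circZ2Z2 a (circZ2Z2 b c))
    one_mul := (by decide : ∀ a : ZMod 2 × ZMod 2, circZ2Z2 (0, 0) a = a)
    mul_one := (by decide : ∀ a : ZMod 2 × ZMod 2, circZ2Z2 a (0, 0) = a)
    inv_mul_cancel := (by decide : ∀ a : ZMod 2 × ZMod 2,
      circZ2Z2 (-a.1 - a.2 * a.2, -a.2) a = (0, 0))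
    mul_add_skew := (by decide : ∀ a b c : ZMod 2 × ZMod 2,
      circZ2Z2 a (b + c) = circZ2Z2 a b - a + circZ2Z2 a c) }

/-- The carrier `ℤ/2 × ℤ/4` of the third skew brace. -/
def BraceZ2Z4 : Type := ZMod 2 × ZMod 4

/-- The class in `ℤ/2` of `∑_{i=1}^{y-1} i`, where `y` is represented in `{0, 1, 2, 3}`
(the sum is empty for `y = 0` and `y = 1`). -/
def sumBelow (y : ZMod 4) : ZMod 2 := ((∑ i ∈ Finset.Ico 1 y.val, i : ℕ) : ZMod 2)

/-- The reduction `ℤ/4 → ℤ/2`. -/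
def redMod2 (y : ZMod 4) : ZMod 2 := ZMod.castHom (by norm_num : 2 ∣ 4) (ZMod 2) y

/-- The operation
`(x₁, y₁) ∘ (x₂, y₂) = (x₁ + x₂ + y₂ ∑_{i=1}^{y₁-1} i, y₁ + y₂ + 2y₁y₂)` on `ℤ/2 × ℤ/4`. -/
def circZ2Z4 (a b : ZMod 2 × ZMod 4) : ZMod 2 × ZMod 4 :=
  (a.1 + b.1 + redMod2 b.2 * sumBelow a.2, a.2 + b.2 + 2 * a.2 * b.2)

/-- The inverse for the operation `circZ2Z4`. -/
def invZ2Z4 (a : ZMod 2 × ZMod 4) : ZMod 2 × ZMod 4 :=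
  (-a.1 - redMod2 a.2 * sumBelow a.2, -a.2 - 2 * a.2 * a.2)

set_option maxRecDepth 100000 in
/-- The usual addition of `ℤ/2 × ℤ/4`, with the operation `circZ2Z4`. -/
instance : SkewBrace BraceZ2Z4 :=
  { (inferInstanceAs (AddGroup (ZMod 2 × ZMod 4)) : AddGroup BraceZ2Z4) with
    mul := circZ2Z4
    one := ((0, 0) : ZMod 2 × ZMod 4)
    inv := invZ2Z4
    mul_assoc := (by decide +kernel : ∀ a b c : ZMod 2 × ZMod 4,
      circZ2Z4 (circZ2Z4 a b) c = circZ2Z4 a (circZ2Z4 b c))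
    one_mul := (by decide +kernel : ∀ a : ZMod 2 × ZMod 4, circZ2Z4 (0, 0) a = a)
    mul_one := (by decide +kernel : ∀ a : ZMod 2 × ZMod 4, circZ2Z4 a (0, 0) = a)
    inv_mul_cancel := (by decide +kernel : ∀ a : ZMod 2 × ZMod 4,
      circZ2Z4 (invZ2Z4 a) a = (0, 0))
    mul_add_skew := (by decide +kernel : ∀ a b c : ZMod 2 × ZMod 4,
      circZ2Z4 a (b + c) = circZ2Z4 a b - a + circZ2Z4 a c) }

end SkewBrace

/-! Let F be the set of points fixed by θ. It is a central additive subgroup, `b * c = b + c` for c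
in F, and the single vertex says that A \ F is one orbit. Transitivity makes everything uniform. If
p is a prime dividing [A : F], all p-multiples lie in F and p kills F, so A is a p-group. The orbit
size |F|([A : F] - 1) divides |A|², which forces [A : F] = 2 (`index_thetaFixed`). As F is central,
A is abelian. Fix x outside F. Then λ_a(x) = x + φ(a), where φ is a homomorphism from (A, ∘) onto F
(`exists_isTwist`), and φ determines the brace. Put v = φ(x), u = φ(v). Since φ² vanishes on F, F =
{0, u, v, u + v} (`IsTwist.eq_of_mem`). What remains is whether u = 0 and which element of F is x +
x; the identity φ(x + x) = u and a change of x leave the three listed braces. -/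

namespace SkewBrace

/-! ### Fixed points of θ and transitivity on their complement -/

section FixedPoints

variable (A : Type*) [SkewBrace A]

/-- The additive subgroup of the elements fixed by `θ`. -/
def thetaFixed : AddSubgroup A where
  carrier := {c | ∀ a b : A, a + (-b + b * c) - a = c}
  zero_mem' a b := by rw [mul_zero_skew]; simp
  add_mem' {c d} hc hd a b := by
    have h := congrArg₂ (· + ·) (hc a b) (hd a b)
    rw [lambda_add]
    simpa [sub_eq_add_neg, add_assoc] using h
  neg_mem' {c} hc a b := by
    have h := congrArg (fun t => -t) (hc a b)
    have h2 : -b + b * -c = -(-b + b * c) := (lambdaEquiv b).map_neg c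
    rw [h2]
    simpa [sub_eq_add_neg, add_assoc] using h

variable {A}

theorem lambda_of_mem_thetaFixed {c : A} (hc : c ∈ thetaFixed A) (b : A) : -b + b * c = c := by
  simpa using hc 0 b

theorem mul_of_mem_thetaFixed {c : A} (hc : c ∈ thetaFixed A) (b : A) : b * c = b + c := by
  have h := lambda_of_mem_thetaFixed hc b
  rw [← h, add_neg_cancel_left, h]

theorem add_comm_of_mem_thetaFixed {c : A} (hc : c ∈ thetaFixed A) (a : A) : a + c = c + a := by
  have h := hc a 0
  rw [lambda_of_mem_thetaFixed hc 0] at h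
  exact eq_add_of_sub_eq h

instance thetaFixed_normal : (thetaFixed A).Normal :=
  ⟨fun c hc a => by rw [add_comm_of_mem_thetaFixed hc a, add_neg_cancel_right]; exact hc⟩

theorem mem_orbit_theta {x y : A} :
    Multiplicative.ofAdd y ∈ orbit (theta A) (Multiplicative.ofAdd x) ↔
      ∃ a b : A, a + (-b + b * x) - a = y := by
  constructor
  · rintro ⟨⟨a, b⟩, h⟩
    exact ⟨a.toAdd, b, (theta_apply a.toAdd b x).symm.trans (congrArg Multiplicative.toAdd h)⟩
  · rintro ⟨a, b, h⟩
    exact ⟨⟨Multiplicative.ofAdd a, b⟩,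
      congrArg Multiplicative.ofAdd ((theta_apply a b x).trans h)⟩

theorem mem_orbit_self {G H : Type*} [Group G] [Group H] (α : G →* MulAut H) (a : H) :
    a ∈ orbit α a := ⟨1, by simp⟩

theorem one_lt_ncard_orbit_theta [Finite A] {x : A} (hx : x ∉ thetaFixed A) :
    1 < (orbit (theta A) (Multiplicative.ofAdd x)).ncard := by
  have : Finite (Multiplicative A) := ‹Finite A›
  have hx' : ¬ ∀ a b : A, a + (-b + b * x) - a = x := hx
  push Not at hx'
  obtain ⟨a, b, hab⟩ := hx'
  refine (Set.one_lt_ncard (Set.toFinite _)).2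
    ⟨_, mem_orbit_theta.2 ⟨a, b, rfl⟩, _, mem_orbit_self _ _, fun h => hab ?_⟩
  exact congrArg Multiplicative.toAdd h

theorem orbit_theta_eq_of_unique [Finite A] (hA : HasExactlyOneVertex (thetaGraph A)) {x y : A}
    (hx : x ∉ thetaFixed A) (hy : y ∉ thetaFixed A) :
    orbit (theta A) (Multiplicative.ofAdd x) = orbit (theta A) (Multiplicative.ofAdd y) := by
  have h := (Nat.card_eq_one_iff_unique.1 hA).1
  exact congrArg Subtype.val (h.elim
    (⟨_, ⟨_, rfl⟩, one_lt_ncard_orbit_theta hx⟩ : NontrivialOrbit (theta A))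
    ⟨_, ⟨_, rfl⟩, one_lt_ncard_orbit_theta hy⟩)

theorem exists_theta_eq_of_unique [Finite A] (hA : HasExactlyOneVertex (thetaGraph A)) {x y : A}
    (hx : x ∉ thetaFixed A) (hy : y ∉ thetaFixed A) : ∃ a b : A, a + (-b + b * x) - a = y := by
  rw [← mem_orbit_theta, orbit_theta_eq_of_unique hA hx hy]
  exact mem_orbit_self _ _

theorem exists_notMem_thetaFixed (hA : HasExactlyOneVertex (thetaGraph A)) :
    ∃ x : A, x ∉ thetaFixed A := by
  obtain ⟨⟨L, ⟨a, rfl⟩, hL⟩⟩ := (Nat.card_eq_one_iff_unique.1 hA).2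
  refine ⟨a.toAdd, fun ha => ?_⟩
  have h : orbit (theta A) a ⊆ {a} := by
    intro y hy
    obtain ⟨b, c, h⟩ := mem_orbit_theta.1 (show Multiplicative.ofAdd y.toAdd ∈
      orbit (theta A) (Multiplicative.ofAdd a.toAdd) from hy)
    exact congrArg Multiplicative.ofAdd (h.symm.trans (ha b c))
  have h2 := Set.ncard_le_ncard h
  rw [Set.ncard_singleton] at h2
  omega

theorem theta_notMem_thetaFixed {x : A} (hx : x ∉ thetaFixed A) (a b : A) :
    a + (-b + b * x) - a ∉ thetaFixed A := by
  intro h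
  have h1 : -b + b * x ∈ thetaFixed A := by
    have := thetaFixed_normal.conj_mem _ h (-a)
    simpa [sub_eq_add_neg, add_assoc] using this
  have h2 := lambda_of_mem_thetaFixed h1 b⁻¹
  rw [← lambda_mul, inv_mul_cancel, lambda_one] at h2
  exact hx (h2 ▸ h1)

theorem theta_nsmul (a b x : A) (n : ℕ) :
    a + (-b + b * (n • x)) - a = n • (a + (-b + b * x) - a) := by
  have h : -b + b * (n • x) = n • (-b + b * x) := map_nsmul (lambdaEquiv b) n x
  rw [h, sub_eq_add_neg, sub_eq_add_neg]
  exact map_nsmul (AddAut.addConj a) n _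

end FixedPoints

/-! ### The fixed subgroup has index two -/

section Index

variable {A : Type*} [SkewBrace A] [Finite A]

/-- Orbit-stabilizer: the complement is an orbit of a semidirect product of order |A|². -/
theorem card_compl_thetaFixed_dvd (hA : HasExactlyOneVertex (thetaGraph A)) :
    ((thetaFixed A : Set A)ᶜ).ncard ∣ Nat.card A * Nat.card A := by
  obtain ⟨x, hx⟩ := exists_notMem_thetaFixed hA
  let S : MulAction (Multiplicative A ⋊[lambda A] A) (Multiplicative A) :=
    MulAction.compHom _ (theta A)
  have h : MulAction.orbit (Multiplicative A ⋊[lambda A] A) (Multiplicative.ofAdd x) =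
      Multiplicative.toAdd ⁻¹' (thetaFixed A : Set A)ᶜ := by
    ext y
    refine (mem_orbit_theta (x := x) (y := y.toAdd)).trans ⟨?_, fun hy => ?_⟩
    · rintro ⟨a, b, h⟩
      exact fun hy => theta_notMem_thetaFixed hx a b (h ▸ hy)
    · exact exists_theta_eq_of_unique hA hx hy
  have h2 := (MulAction.stabilizer (Multiplicative A ⋊[lambda A] A)
    (Multiplicative.ofAdd x)).index_dvd_card
  rw [MulAction.index_stabilizer, h, SemidirectProduct.card] at h2
  exact h2

/-- Cauchy in the quotient gives one such element outside F; θ commutes with multiples and moves it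
to every other element outside F. -/
theorem exists_prime_nsmul_mem (hA : HasExactlyOneVertex (thetaGraph A)) {p : ℕ}
    (hp : p.Prime) (hd : p ∣ (thetaFixed A).index) (y : A) : p • y ∈ thetaFixed A := by
  have := Fact.mk hp
  obtain ⟨q, hq⟩ := exists_prime_addOrderOf_dvd_card' (G := A ⧸ thetaFixed A) p hd
  obtain ⟨z, rfl⟩ := QuotientAddGroup.mk_surjective q
  have hz : z ∉ thetaFixed A := by
    intro h
    rw [(QuotientAddGroup.eq_zero_iff z).2 h, addOrderOf_zero] at hq
    exact hp.one_lt.ne hq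
  have hpz : p • z ∈ thetaFixed A := by
    rw [← QuotientAddGroup.eq_zero_iff, QuotientAddGroup.mk_nsmul, ← hq]
    exact addOrderOf_nsmul_eq_zero _
  by_cases hy : y ∈ thetaFixed A
  · exact nsmul_mem hy p
  · obtain ⟨a, b, rfl⟩ := exists_theta_eq_of_unique hA hz hy
    rw [← theta_nsmul, hpz a b]
    exact hpz

/-- Some θ sends x to x + c. It fixes p • x, so p • x = p • (x + c) = p • x + p • c. -/
theorem nsmul_eq_zero_of_mem_thetaFixed (hA : HasExactlyOneVertex (thetaGraph A)) {p : ℕ}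
    (h : ∀ y : A, p • y ∈ thetaFixed A) {c : A} (hc : c ∈ thetaFixed A) : p • c = 0 := by
  obtain ⟨x, hx⟩ := exists_notMem_thetaFixed hA
  have hxc : x + c ∉ thetaFixed A := fun h => hx ((AddSubgroup.add_mem_cancel_right _ hc).1 h)
  obtain ⟨a, b, hab⟩ := exists_theta_eq_of_unique hA hx hxc
  have h2 := theta_nsmul a b x p
  have h3 : AddCommute x c := add_comm_of_mem_thetaFixed hc x
  rw [h x a b, hab, h3.add_nsmul] at h2
  simpa using h2

theorem index_thetaFixed (hA : HasExactlyOneVertex (thetaGraph A)) :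
    (thetaFixed A).index = 2 := by
  obtain ⟨x, hx⟩ := exists_notMem_thetaFixed hA
  have h1 : (thetaFixed A).index ≠ 1 := by
    rw [Ne, AddSubgroup.index_eq_one]
    rintro h
    exact hx (h ▸ AddSubgroup.mem_top x)
  have h0 : (thetaFixed A).index ≠ 0 := AddSubgroup.index_ne_zero_of_finite
  obtain ⟨p, hp, hd⟩ := Nat.exists_prime_and_dvd h1
  have hmem := exists_prime_nsmul_mem hA hp hd
  have hcard := (thetaFixed A).card_mul_index
  have hcompl : ((thetaFixed A : Set A)ᶜ).ncard =
      Nat.card (thetaFixed A) * ((thetaFixed A).index - 1) := by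
    rw [Nat.mul_sub, hcard, mul_one, Set.ncard_compl]
    rfl
  have hdvd : (thetaFixed A).index - 1 ∣ Nat.card A * Nat.card A :=
    (Dvd.intro_left _ hcompl.symm).trans (card_compl_thetaFixed_dvd hA)
  by_contra h2
  -- A prime q dividing the index minus 1 divides |A|. Since p² kills A, Cauchy gives q = p, yet p
  -- cannot divide two consecutive integers.
  obtain ⟨q, hq, hqd⟩ := Nat.exists_prime_and_dvd (n := (thetaFixed A).index - 1) (by omega)
  have := Fact.mk hq
  obtain ⟨y, hy⟩ := exists_prime_addOrderOf_dvd_card' (G := A) q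
    (by simpa using hq.dvd_mul.1 (hqd.trans hdvd))
  have h3 : (p * p) • y = 0 := by
    rw [mul_nsmul]
    exact nsmul_eq_zero_of_mem_thetaFixed hA hmem (hmem y)
  have h4 : q ∣ p * p := hy ▸ addOrderOf_dvd_of_nsmul_eq_zero h3
  have h5 : q = p := (Nat.prime_dvd_prime_iff_eq hq hp).1 (by simpa using hq.dvd_mul.1 h4)
  subst h5
  have h6 := (Nat.dvd_sub hd hqd)
  rw [Nat.sub_sub_self (by omega)] at h6
  exact hq.one_lt.ne' (Nat.dvd_one.1 h6)

theorem isOfAbelianType_of_unique (hA : HasExactlyOneVertex (thetaGraph A)) :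
    IsOfAbelianType A := by
  intro a b
  have hi := AddSubgroup.add_mem_iff_of_index_two (index_thetaFixed hA) (a := -a) (b := b)
  rw [neg_mem_iff] at hi
  by_cases ha : a ∈ thetaFixed A
  · exact (add_comm_of_mem_thetaFixed ha b).symm
  by_cases hb : b ∈ thetaFixed A
  · exact add_comm_of_mem_thetaFixed hb a
  have h := add_comm_of_mem_thetaFixed (hi.2 (iff_of_false ha hb)) a
  rw [add_neg_cancel_left] at h
  rw [h, ← add_assoc, ← add_assoc, add_neg_cancel, zero_add, ← h]

end Index

/-- An index-two subgroup `F` of the additive group, a complement representative `x` and a map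
`φ : A → F` that determine the multiplication: `a ∘ c = a + c` and
`a ∘ (c + x) = a + (c + x) + φ a` for `c ∈ F`. -/
structure IsTwist {A : Type*} [SkewBrace A] (F : AddSubgroup A) (x : A) (φ : A → A) : Prop where
  comm : IsOfAbelianType A
  notMem : x ∉ F
  exists_add : ∀ a, a ∉ F → ∃ c ∈ F, a = c + x
  mul_mem : ∀ a, ∀ c ∈ F, a * c = a + c
  mul_add_mem : ∀ a, ∀ c ∈ F, a * (c + x) = a + (c + x) + φ a
  map_mem : ∀ a, φ a ∈ F
  map_mul : ∀ a b, φ (a * b) = φ a + φ b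
  two_mem : x + x ∈ F
  add_self : ∀ c ∈ F, c + c = 0
  surj : ∀ c ∈ F, ∃ a, φ a = c
  nontrivial : ∃ a, φ a ≠ 0

/-- With index two, λ_b(x) stays in the coset of x, so φ(b) = λ_b(x) - x lies in F. It is additive
along ∘ because λ is an action fixing F pointwise, and onto F because the orbit of x is all of x +
F. -/
theorem exists_isTwist {A : Type*} [SkewBrace A] [Finite A]
    (hA : HasExactlyOneVertex (thetaGraph A)) :
    ∃ (x : A) (φ : A → A), IsTwist (thetaFixed A) x φ := by
  obtain ⟨x, hx⟩ := exists_notMem_thetaFixed hA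
  have hi := index_thetaFixed hA
  have hc := isOfAbelianType_of_unique hA
  have hl : ∀ b, -b + b * x = (-x + (-b + b * x)) + x := fun b => by
    rw [hc _ x, add_neg_cancel_left]
  have hmem : ∀ b, -x + (-b + b * x) ∈ thetaFixed A := fun b => by
    rw [AddSubgroup.add_mem_iff_of_index_two hi, neg_mem_iff]
    refine iff_of_false hx ?_
    simpa using theta_notMem_thetaFixed hx 0 b
  have h2 : ∀ y : A, 2 • y ∈ thetaFixed A :=
    exists_prime_nsmul_mem hA Nat.prime_two hi.symm.dvd
  have hs : ∀ c ∈ thetaFixed A, ∃ a, -x + (-a + a * x) = c := fun c hcm => by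
    have hxc : x + c ∉ thetaFixed A :=
      fun h => hx ((AddSubgroup.add_mem_cancel_right _ hcm).1 h)
    obtain ⟨a, b, hab⟩ := exists_theta_eq_of_unique hA hx hxc
    refine ⟨b, ?_⟩
    rw [hc a, add_sub_cancel_right] at hab
    rw [hab, neg_add_cancel_left]
  refine ⟨x, fun b => -x + (-b + b * x), hc, hx, fun a ha => ⟨a - x, ?_, ?_⟩,
    fun a c h => mul_of_mem_thetaFixed h a, fun a c h => ?_, hmem, fun a b => ?_, ?_,
    fun c h => ?_, hs, ?_⟩
  · rw [sub_eq_add_neg, AddSubgroup.add_mem_iff_of_index_two hi, neg_mem_iff]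
    exact iff_of_false ha hx
  · rw [sub_add_cancel]
  · have h1 : -a + a * (c + x) = (-x + (-a + a * x)) + (c + x) := by
      rw [lambda_add, lambda_of_mem_thetaFixed h, ← add_assoc _ c, hc _ c, add_assoc c, ← hl a]
    rw [add_assoc a, hc (c + x), ← h1, add_neg_cancel_left]
  · have h1 := lambda_mul a b x
    rw [hl b, lambda_add, lambda_of_mem_thetaFixed (hmem b), hl a] at h1
    change -x + _ = _
    rw [h1, ← add_assoc _ _ x, hc _ x, neg_add_cancel_left, hc]
  · simpa [two_nsmul] using h2 x
  · simpa [two_nsmul] using nsmul_eq_zero_of_mem_thetaFixed hA h2 h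
  · by_contra! hn
    refine hx fun a b => ?_
    have h := hl b
    rw [hn b, zero_add] at h
    rw [h, hc a, add_sub_cancel_right]

/-! ### Structure of F in terms of φ -/

namespace IsTwist

variable {A : Type*} [SkewBrace A] {F : AddSubgroup A} {x : A} {φ : A → A}

theorem map_add_mem (h : IsTwist F x φ) (a : A) {c : A} (hc : c ∈ F) : φ (a + c) = φ a + φ c := by
  rw [← h.mul_mem a c hc, h.map_mul]

theorem map_zero (h : IsTwist F x φ) : φ 0 = 0 := by
  simpa using h.map_add_mem 0 F.zero_mem

theorem mul_x (h : IsTwist F x φ) (a : A) : a * x = a + x + φ a := by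
  simpa using h.mul_add_mem a 0 F.zero_mem

theorem map_nsmul_eq_zero (h : IsTwist F x φ) {c : A} (hc : c ∈ F) (h0 : φ c = 0) (n : ℕ) :
    φ (n • c) = 0 := by
  induction n with
  | zero => rw [zero_nsmul, h.map_zero]
  | succ n ih => rw [succ_nsmul, h.map_add_mem _ hc, ih, h0, add_zero]

/-- Apply φ to `c * x = c + x + φ c` and compare with φ(c) + φ(x). -/
theorem map_map (h : IsTwist F x φ) {c : A} (hc : c ∈ F) : φ (φ c) = 0 := by
  have h1 := h.map_mul c x
  rw [h.mul_x, h.map_add_mem _ (h.map_mem c), h.comm c x, h.map_add_mem _ hc, h.comm (φ x)] at h1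
  simpa using h1

/-- Apply φ to `x * x = x + x + φ x`: the left side is 2φ(x) = 0, and signs do not matter in F. -/
theorem map_two (h : IsTwist F x φ) : φ (x + x) = φ (φ x) := by
  have h1 := h.map_mul x x
  rw [h.mul_x, h.map_add_mem _ (h.map_mem x), h.add_self _ (h.map_mem x)] at h1
  rw [eq_neg_of_add_eq_zero_left h1, neg_eq_iff_add_eq_zero, h.add_self _ (h.map_mem _)]

theorem eq_of_mem (h : IsTwist F x φ) {c : A} (hc : c ∈ F) :
    c = 0 ∨ c = φ (φ x) ∨ c = φ x ∨ c = φ (φ x) + φ x := by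
  have key : ∀ c ∈ F, ∃ d ∈ F, c = φ d ∨ c = φ d + φ x := fun c hc => by
    obtain ⟨a, rfl⟩ := h.surj c hc
    by_cases ha : a ∈ F
    · exact ⟨a, ha, Or.inl rfl⟩
    · obtain ⟨d, hd, rfl⟩ := h.exists_add a ha
      exact ⟨d, hd, Or.inr (by rw [h.comm, h.map_add_mem _ hd, h.comm])⟩
  -- Elements of F are φ(e) or φ(e) + φ(x) with e in F, and φ² kills e.
  have key2 : ∀ d ∈ F, φ d = 0 ∨ φ d = φ (φ x) := fun d hd => by
    obtain ⟨e, he, rfl | rfl⟩ := key d hd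
    · exact Or.inl (h.map_map he)
    · right
      rw [h.map_add_mem _ (h.map_mem x), h.map_map he, zero_add]
  obtain ⟨d, hd, rfl | rfl⟩ := key c hc <;> rcases key2 d hd with h1 | h1 <;> simp [h1]

theorem add_add_self (h : IsTwist F x φ) {c : A} (hc : c ∈ F) : (c + x) + (c + x) = x + x := by
  calc (c + x) + (c + x) = (x + c) + (c + x) := by rw [h.comm x c]
    _ = x + x := by rw [add_assoc, ← add_assoc c, h.add_self c hc, zero_add]

/-- Replacing `x` by another representative of its coset. -/
theorem translate (h : IsTwist F x φ) {c : A} (hc : c ∈ F) : IsTwist F (c + x) φ where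
  comm := h.comm
  notMem := fun h1 => h.notMem ((AddSubgroup.add_mem_cancel_left _ hc).1 h1)
  exists_add a ha := by
    obtain ⟨d, hd, rfl⟩ := h.exists_add a ha
    exact ⟨d - c, sub_mem hd hc, by rw [← add_assoc, sub_add_cancel]⟩
  mul_mem := h.mul_mem
  mul_add_mem a d hd := by
    rw [← add_assoc d, h.mul_add_mem _ _ (add_mem hd hc)]
  map_mem := h.map_mem
  map_mul := h.map_mul
  two_mem := by
    rw [h.add_add_self hc]
    exact h.two_mem
  add_self := h.add_self
  surj := h.surj
  nontrivial := h.nontrivial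

/-- A twist is carried along by a bijective additive map that respects its data. -/
theorem nonempty_ringEquiv (h : IsTwist F x φ) {B : Type*} [SkewBrace B] (g : B →+ A)
    (hg : Function.Bijective g) (ψ : B → B) (P : B → Prop)
    (hmul : ∀ p q : B, P q → p * q = p + q) (hmul' : ∀ p q : B, ¬ P q → p * q = p + q + ψ p)
    (hP : ∀ q, P q ↔ g q ∈ F) (hψ : ∀ p, g (ψ p) = φ (g p)) : Nonempty (A ≃+* B) := by
  have hgm : ∀ p q, g (p * q) = g p * g q := fun p q => by
    by_cases hq : P q
    · rw [hmul p q hq, g.map_add, h.mul_mem _ _ ((hP q).1 hq)]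
    · obtain ⟨c, hc, hcq⟩ := h.exists_add _ (fun h1 => hq ((hP q).2 h1))
      rw [hmul' p q hq, g.map_add, g.map_add, hψ, hcq, h.mul_add_mem _ _ hc]
  exact ⟨RingEquiv.symm
    { Equiv.ofBijective g hg with
      map_mul' := hgm
      map_add' := g.map_add }⟩

theorem surjective_of_mem_range (h : IsTwist F x φ) {B : Type*} [AddGroup B] (g : B →+ A)
    (hx : x ∈ g.range) (hv : φ x ∈ g.range) (hu : φ (φ x) ∈ g.range) : Function.Surjective g := by
  have hF : ∀ c ∈ F, c ∈ g.range := fun c hc => by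
    rcases h.eq_of_mem hc with rfl | rfl | rfl | rfl
    exacts [zero_mem _, hu, hv, add_mem hu hv]
  intro a
  by_cases ha : a ∈ F
  · exact hF a ha
  · obtain ⟨c, hc, rfl⟩ := h.exists_add a ha
    exact add_mem (hF c hc) hx

theorem add_x_notMem (h : IsTwist F x φ) {c : A} (hc : c ∈ F) : c + x ∉ F :=
  (h.translate hc).notMem

theorem map_add_x (h : IsTwist F x φ) {c : A} (hc : c ∈ F) : φ (c + x) = φ c + φ x := by
  rw [h.comm, h.map_add_mem _ hc, h.comm]

theorem map_x_ne_zero (h : IsTwist F x φ) : φ x ≠ 0 := by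
  intro hv
  obtain ⟨a, ha⟩ := h.nontrivial
  have := h.eq_of_mem (h.map_mem a)
  simp [hv, h.map_zero, ha] at this

end IsTwist

/-- The homomorphism `ℤ/n → A` sending `1` to `a`, where `n • a = 0`. -/
def zmodHom {A : Type*} [AddGroup A] (n : ℕ) (a : A) (ha : n • a = 0) : ZMod n →+ A :=
  ZMod.lift n ⟨zmultiplesHom A a, by simpa using ha⟩

theorem zmodHom_natCast {A : Type*} [AddGroup A] (n : ℕ) (a : A) (ha : n • a = 0) (k : ℕ) :
    zmodHom n a ha (k : ZMod n) = k • a := by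
  have := ZMod.lift_coe n ⟨zmultiplesHom A a, by simpa using ha⟩ (k : ℤ)
  simpa [zmodHom] using this

/-- Residues appear as casts of naturals so that homomorphism values rewrite to natural multiples.
-/
theorem zmod_two_cases : ∀ a : ZMod 2, a = ((0 : ℕ) : ZMod 2) ∨ a = ((1 : ℕ) : ZMod 2) := by
  decide

theorem zmod_four_cases : ∀ a : ZMod 4, a = ((0 : ℕ) : ZMod 4) ∨ a = ((1 : ℕ) : ZMod 4) ∨
    a = ((2 : ℕ) : ZMod 4) ∨ a = ((3 : ℕ) : ZMod 4) := by
  decide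

/-! ### Identification with the three braces -/

namespace IsTwist

variable {A : Type*} [SkewBrace A] {F : AddSubgroup A} {x : A} {φ : A → A}

theorem three_nsmul (x : A) : 3 • x = (x + x) + x := by
  rw [succ_nsmul, two_nsmul]

theorem four_nsmul_eq_zero (h : IsTwist F x φ) : 4 • x = 0 := by
  rw [show 4 = 2 * 2 from rfl, mul_nsmul, two_nsmul, two_nsmul, h.add_self _ h.two_mem]

theorem ringEquiv_braceZ4 (h : IsTwist F x φ) (hu : φ (φ x) = 0) (hx : x + x = φ x) :
    Nonempty (A ≃+* BraceZ4) := by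
  let g : ZMod 4 →+ A := zmodHom 4 x h.four_nsmul_eq_zero
  have hg : ∀ k : ℕ, g k = k • x := zmodHom_natCast 4 x h.four_nsmul_eq_zero
  have hP : ∀ q : ZMod 4, (q = 0 ∨ q = 2) ↔ g q ∈ F := fun q => by
    rcases zmod_four_cases q with rfl | rfl | rfl | rfl <;> rw [hg]
    · simp
    · rw [one_nsmul]
      exact iff_of_false (by decide) h.notMem
    · rw [two_nsmul]
      exact iff_of_true (by decide) h.two_mem
    · rw [three_nsmul]
      exact iff_of_false (by decide) (h.add_x_notMem h.two_mem)
  have hψ : ∀ p : ZMod 4, g (2 * p) = φ (g p) := fun p => by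
    have h2 : g (2 * p) = 2 • g p := by rw [← map_nsmul, nsmul_eq_mul]; rfl
    rw [h2, two_nsmul]
    rcases zmod_four_cases p with rfl | rfl | rfl | rfl <;> rw [hg]
    · simp [h.map_zero]
    · rw [one_nsmul, hx]
    · rw [two_nsmul, h.add_self _ h.two_mem, h.map_two, hu]
    · rw [three_nsmul, h.map_add_x h.two_mem, h.map_two, hu, zero_add,
        h.add_add_self h.two_mem, hx]
  refine h.nonempty_ringEquiv (B := BraceZ4) g ⟨?_, ?_⟩ (fun p : ZMod 4 => (2 * p : ZMod 4))
    (fun q : ZMod 4 => q = 0 ∨ q = 2) ?_ ?_ hP hψ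
  · refine (injective_iff_map_eq_zero g).2 fun q hq => ?_
    have hqF : g q ∈ F := hq ▸ F.zero_mem
    rcases (hP q).2 hqF with rfl | rfl
    · rfl
    · have h2 := hg 2
      rw [two_nsmul, hx] at h2
      exact absurd (h2.symm.trans hq) h.map_x_ne_zero
  · refine h.surjective_of_mem_range g ⟨(1 : ℕ), ?_⟩ ⟨(2 : ℕ), ?_⟩ ?_
    · rw [hg, one_nsmul]
    · rw [hg, two_nsmul, hx]
    · rw [hu]
      exact zero_mem _
  · exact (by decide : ∀ p q : ZMod 4, q = 0 ∨ q = 2 → p + q + 2 * p * q = p + q)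
  · exact (by decide : ∀ p q : ZMod 4, ¬(q = 0 ∨ q = 2) → p + q + 2 * p * q = p + q + 2 * p)

/-- The homomorphism `ℤ/m × ℤ/n → A` sending the standard generators to `a` and `b`. -/
def zmodProdHom (hc : IsOfAbelianType A) (m n : ℕ) (a b : A) (ha : m • a = 0) (hb : n • b = 0) :
    ZMod m × ZMod n →+ A :=
  (zmodHom m a ha).noncommCoprod (zmodHom n b hb) fun _ _ => hc _ _

theorem zmodProdHom_natCast (hc : IsOfAbelianType A) (m n : ℕ) (a b : A) (ha : m • a = 0)
    (hb : n • b = 0) (j k : ℕ) :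
    zmodProdHom hc m n a b ha hb ((j : ZMod m), (k : ZMod n)) = j • a + k • b := by
  rw [← zmodHom_natCast m a ha, ← zmodHom_natCast n b hb]
  rfl

theorem ringEquiv_braceZ2Z2 (h : IsTwist F x φ) (hu : φ (φ x) = 0) (hx : x + x = 0) :
    Nonempty (A ≃+* BraceZ2Z2) := by
  have h2v : 2 • φ x = 0 := by rw [two_nsmul, h.add_self _ (h.map_mem x)]
  have h2x : 2 • x = 0 := by rw [two_nsmul, hx]
  let g : ZMod 2 × ZMod 2 →+ A := zmodProdHom h.comm 2 2 (φ x) x h2v h2x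
  have hg : ∀ j k : ℕ, g (j, k) = j • φ x + k • x := zmodProdHom_natCast h.comm 2 2 _ _ h2v h2x
  have hjF : ∀ j : ℕ, j • φ x ∈ F := fun j => nsmul_mem (h.map_mem x) j
  have hP : ∀ (a : ZMod 2) (b : ZMod 2), b = 0 ↔ g (a, b) ∈ F := fun a b => by
    obtain ⟨j, rfl⟩ := ZMod.natCast_zmod_surjective a
    rcases zmod_two_cases b with rfl | rfl <;> rw [hg]
    · rw [zero_nsmul, add_zero]
      exact iff_of_true (by decide) (hjF j)
    · rw [one_nsmul]
      exact iff_of_false (by decide) (h.add_x_notMem (hjF j))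
  have hψ : ∀ (a : ZMod 2) (b : ZMod 2), g (b, 0) = φ (g (a, b)) := fun a b => by
    obtain ⟨j, rfl⟩ := ZMod.natCast_zmod_surjective a
    have hj := h.map_nsmul_eq_zero (h.map_mem x) hu j
    rcases zmod_two_cases b with rfl | rfl
    · refine (hg 0 0).trans ?_
      rw [hg, zero_nsmul, zero_nsmul, add_zero, add_zero, hj]
    · refine (hg 1 0).trans ?_
      rw [hg, one_nsmul, zero_nsmul, add_zero, one_nsmul, h.map_add_x (hjF j), hj, zero_add]
  refine h.nonempty_ringEquiv (B := BraceZ2Z2) g ⟨?_, ?_⟩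
    (fun p : ZMod 2 × ZMod 2 => ((p.2, 0) : ZMod 2 × ZMod 2))
    (fun q : ZMod 2 × ZMod 2 => q.2 = 0) ?_ ?_ (fun q => hP q.1 q.2)
    fun p => hψ p.1 p.2
  · refine (injective_iff_map_eq_zero g).2 fun q hq => ?_
    have hqF : g q ∈ F := hq ▸ F.zero_mem
    obtain ⟨a, b⟩ := q
    obtain rfl : b = ((0 : ℕ) : ZMod 2) := by simpa using (hP _ _).2 hqF
    rcases zmod_two_cases a with rfl | rfl
    · rfl
    · rw [hg, one_nsmul, zero_nsmul, add_zero] at hq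
      exact absurd hq h.map_x_ne_zero
  · refine h.surjective_of_mem_range g ⟨((0 : ℕ), (1 : ℕ)), ?_⟩ ⟨((1 : ℕ), (0 : ℕ)), ?_⟩ ?_
    · rw [hg, one_nsmul, zero_nsmul, zero_add]
    · rw [hg, one_nsmul, zero_nsmul, add_zero]
    · rw [hu]
      exact zero_mem _
  · exact (by decide : ∀ p q : ZMod 2 × ZMod 2, q.2 = 0 → circZ2Z2 p q = p + q)
  · exact (by decide : ∀ p q : ZMod 2 × ZMod 2, ¬ q.2 = 0 → circZ2Z2 p q = p + q + (p.2, 0))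

theorem ringEquiv_braceZ2Z4 (h : IsTwist F x φ) (hu : φ (φ x) ≠ 0) (hx : x + x = φ x) :
    Nonempty (A ≃+* BraceZ2Z4) := by
  have h2u : 2 • φ (φ x) = 0 := by rw [two_nsmul, h.add_self _ (h.map_mem _)]
  have h4x := h.four_nsmul_eq_zero
  let g : ZMod 2 × ZMod 4 →+ A := zmodProdHom h.comm 2 4 (φ (φ x)) x h2u h4x
  have hg : ∀ j k : ℕ, g (j, k) = j • φ (φ x) + k • x :=
    zmodProdHom_natCast h.comm 2 4 _ _ h2u h4x
  have hjF : ∀ j : ℕ, j • φ (φ x) ∈ F := fun j => nsmul_mem (h.map_mem _) j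
  have hP : ∀ (a : ZMod 2) (b : ZMod 4), (b = 0 ∨ b = 2) ↔ g (a, b) ∈ F := fun a b => by
    obtain ⟨j, rfl⟩ := ZMod.natCast_zmod_surjective a
    rcases zmod_four_cases b with rfl | rfl | rfl | rfl <;> rw [hg]
    · rw [zero_nsmul, add_zero]
      exact iff_of_true (by decide) (hjF j)
    · rw [one_nsmul]
      exact iff_of_false (by decide) (h.add_x_notMem (hjF j))
    · rw [two_nsmul]
      exact iff_of_true (by decide) (add_mem (hjF j) h.two_mem)
    · rw [three_nsmul, ← add_assoc]
      exact iff_of_false (by decide) (h.add_x_notMem (add_mem (hjF j) h.two_mem))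
  have hψ : ∀ (a : ZMod 2) (b : ZMod 4), g (sumBelow b, 2 * b) = φ (g (a, b)) := fun a b => by
    obtain ⟨j, rfl⟩ := ZMod.natCast_zmod_surjective a
    have hj := h.map_nsmul_eq_zero (h.map_mem _) (h.map_map (h.map_mem x)) j
    rcases zmod_four_cases b with rfl | rfl | rfl | rfl
    · refine (hg 0 0).trans ?_
      rw [hg, zero_nsmul, zero_nsmul, add_zero, add_zero, hj]
    · refine (hg 0 2).trans ?_
      rw [hg, one_nsmul, h.map_add_x (hjF j), hj, zero_nsmul, zero_add, zero_add, two_nsmul, hx]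
    · refine (hg 1 0).trans ?_
      rw [hg, two_nsmul, h.map_add_mem _ h.two_mem, hj, h.map_two, one_nsmul, zero_nsmul,
        add_zero, zero_add]
    -- The sum 1 + 2 is odd, and 2 · 3 = 2 in ℤ/4.
    · refine (congrArg g (show _ = (((1 : ℕ) : ZMod 2), ((2 : ℕ) : ZMod 4)) by decide)).trans ?_
      rw [hg]
      rw [hg, three_nsmul, ← add_assoc, h.map_add_x (add_mem (hjF j) h.two_mem),
        h.map_add_mem _ h.two_mem, hj, h.map_two, one_nsmul, two_nsmul, zero_add, hx]
  refine h.nonempty_ringEquiv (B := BraceZ2Z4) g ⟨?_, ?_⟩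
    (fun p : ZMod 2 × ZMod 4 => ((sumBelow p.2, 2 * p.2) : ZMod 2 × ZMod 4))
    (fun q : ZMod 2 × ZMod 4 => q.2 = 0 ∨ q.2 = 2) ?_ ?_ (fun q => hP q.1 q.2)
    fun p => hψ p.1 p.2
  · refine (injective_iff_map_eq_zero g).2 fun q hq => ?_
    have hqF : g q ∈ F := hq ▸ F.zero_mem
    obtain ⟨a, b⟩ := q
    obtain hb | hb := (hP _ _).2 hqF
    · obtain rfl : b = ((0 : ℕ) : ZMod 4) := by simpa using hb
      rcases zmod_two_cases a with rfl | rfl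
      · rfl
      · rw [hg, one_nsmul, zero_nsmul, add_zero] at hq
        exact absurd hq hu
    · obtain rfl : b = ((2 : ℕ) : ZMod 4) := by simpa using hb
      refine absurd ?_ hu
      -- Applying φ to j • u + 2 • x = 0 leaves u = 0.
      have h1 := congrArg φ hq
      obtain ⟨j, rfl⟩ := ZMod.natCast_zmod_surjective a
      have hj := h.map_nsmul_eq_zero (h.map_mem _) (h.map_map (h.map_mem x)) j
      rw [hg, two_nsmul, h.map_add_mem _ h.two_mem, h.map_two, hj, zero_add, h.map_zero] at h1
      exact h1
  · refine h.surjective_of_mem_range g ⟨((0 : ℕ), (1 : ℕ)), ?_⟩ ⟨((0 : ℕ), (2 : ℕ)), ?_⟩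
      ⟨((1 : ℕ), (0 : ℕ)), ?_⟩
    · rw [hg, one_nsmul, zero_nsmul, zero_add]
    · rw [hg, two_nsmul, zero_nsmul, zero_add, hx]
    · rw [hg, one_nsmul, zero_nsmul, add_zero]
  · exact (by decide +kernel : ∀ p q : ZMod 2 × ZMod 4,
      q.2 = 0 ∨ q.2 = 2 → circZ2Z4 p q = p + q)
  · exact (by decide +kernel : ∀ p q : ZMod 2 × ZMod 4,
      ¬(q.2 = 0 ∨ q.2 = 2) → circZ2Z4 p q = p + q + (sumBelow p.2, 2 * p.2))

end IsTwist

end SkewBrace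

theorem mainTheorem6 (A : Type*) [SkewBrace A] [Finite A]
    (hA : SkewBrace.HasExactlyOneVertex (SkewBrace.thetaGraph A)) :
    SkewBrace.IsOfAbelianType A ∧
      (Nonempty (A ≃+* SkewBrace.BraceZ4) ∨
        Nonempty (A ≃+* SkewBrace.BraceZ2Z2) ∨
        Nonempty (A ≃+* SkewBrace.BraceZ2Z4)) := by
  obtain ⟨x, φ, h⟩ := SkewBrace.exists_isTwist hA
  refine ⟨h.comm, ?_⟩
  by_cases hu : φ (φ x) = 0
  · rcases h.eq_of_mem h.two_mem with h1 | h1 | h1 | h1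
    · exact Or.inr (Or.inl (h.ringEquiv_braceZ2Z2 hu h1))
    · exact Or.inr (Or.inl (h.ringEquiv_braceZ2Z2 hu (h1.trans hu)))
    · exact Or.inl (h.ringEquiv_braceZ4 hu h1)
    · exact Or.inl (h.ringEquiv_braceZ4 hu (by rw [h1, hu, zero_add]))
  · have h2 := h.map_two
    have hv := h.map_mem x
    rcases h.eq_of_mem h.two_mem with h1 | h1 | h1 | h1
    · rw [h1, h.map_zero] at h2
      exact absurd h2.symm hu
    · rw [h1, h.map_map hv] at h2
      exact absurd h2.symm hu
    · exact Or.inr (Or.inr (h.ringEquiv_braceZ2Z4 hu h1))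
    -- Here x + x = u + v. Replacing x by v + x keeps the double and changes φ(x) to u + v.
    · refine Or.inr (Or.inr ((h.translate hv).ringEquiv_braceZ2Z4 ?_ ?_))
      · rwa [h.map_add_x hv, h.map_add_mem _ hv, h.map_map hv, zero_add]
      · rw [h.map_add_x hv, ← h1, h.add_add_self hv]
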